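/- A representation of a set $X$ is a surjective partial map $\delta:\subseteq\mathbb{N}^{\mathbb{N}}\to X$; then $(X,\delta)$ is a represented space. A partial function $F:\subseteq\mathbb{N}^{\mathbb{N}}\to\mathbb{N}^{\mathbb{N}}$ realizes a partial map $f:\subseteq X\to Y$ between represented spaces $(X,\delta_X)$, $(Y,\delta_Y)$ if $\delta_Y(F(p))=f(\delta_X(p))$ for all $p\in\mathrm{dom}(f\circ\delta_X)$, and $f$ is computable if it has a computable realizer. An injective map $f:X\to Y$ is a computable embedding if $f$ and its partial inverse $f^{-1}:\subseteq Y\to X$ are computable. The final topology of $(X,\delta)$ is $$\mathcal{O}(X)=\{U\subseteq X:\delta^{-1}(U)\text{ is open in }\mathrm{dom}(\delta)\}.$$ It carries the representation $\delta_{\mathcal{O}(X)}$ in which $q$ is a name of $U$ if $q$ is a name, in the standard function space representation, of the characteristic function $\chi_U:X\to\mathbb{S}$; that is, the partial continuous function $\Phi_q:\subseteq\mathbb{N}^{\mathbb{N}}\to\mathbb{N}^{\mathbb{N}}$ encoded by $q$ realizes $\chi_U$. Here $\mathbb{S}=\{0,1\}$ is the Sierpiński space, in which the zero sequence is the only name of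 $0$ and all other sequences are names of $1$. Applying this construction to $(\mathcal{O}(X),\delta_{\mathcal{O}(X)})$ yields $\mathcal{OO}(X)$ with its representation $\delta_{\mathcal{OO}(X)}$. The neighborhood map of $X$ is $\mathcal{U}:X\to\mathcal{OO}(X)$, $x\mapsto\{U\in\mathcal{O}(X):x\in U\}$, and $X$ is called a computable Kolmogorov space if $\mathcal{U}$ is a computable embedding. For representations $\delta_1$ of $X_1$ and $\delta_2$ of $X_2$, $\delta_1\le\delta_2$ means that $X_1\subseteq X_2$ and the inclusion $X_1\to X_2$ is computable; $\delta_1\equiv\delta_2$ means $\delta_1\le\delta_2$ and $\delta_2\le\delta_1$. **Theorem.** Let $(X,\delta)$ be a represented space whose final topology $\mathcal{O}(X)$ is $T_0$. Then $\delta^\bullet:=\mathcal{U}^{-1}\circ\delta_{\mathcal{OO}(X)}$, that is, $\delta^\bullet(p)=x:\iff\delta_{\mathcal{OO}(X)}(p)=\mathcal{U}(x)$, is a representation of $X$ such that $X^\bullet:=(X,\delta^\bullet)$ is a computable Kolmogorov space, $\mathcal{O}(X^\bullet)=\mathcal{O}(X)$, and $\delta_{\mathcal{O}(X^\bullet)}\equiv\delta_{\mathcal{O}(X)}$.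 -/

import Mathlib

open Topology

/-- Baire space `ℕ^ℕ`, with its product topology. -/
abbrev Baire : Type := ℕ → ℕ

/-- The finite prefix `p(0), …, p(k-1)` of an infinite sequence. -/
def Baire.pre (p : Baire) (k : ℕ) : List ℕ := (List.range k).map p

/-- `F :⊆ ℕ^ℕ → ℕ^ℕ` is computable: some computable function `f` on finite words that is monotone
for the prefix order satisfies `F(p) = sup_k f(p(0) … p(k-1))` for all `p ∈ dom F`; that is, a
machine that reads longer and longer prefixes of `p` writes longer and longer prefixes of `F(p)`. -/
def ComputableOnBaire (F : Baire →. Baire) : Prop :=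
  ∃ f : List ℕ → List ℕ, Computable f ∧ (∀ v w, v <+: w → f v <+: f w) ∧
    ∀ p, ∀ r ∈ F p,
      (∀ k, f (p.pre k) = r.pre (f (p.pre k)).length) ∧ ∀ m, ∃ k, m ≤ (f (p.pre k)).length

/-- The `n`-th value of the partial continuous function with Kleene associate `q`, at `p`: it is
`v` if `q⟨n, p(0), …, p(k-1)⟩ = v + 1` for the least `k` at which `q` is nonzero. -/
def kleeneValue (q p : Baire) (n : ℕ) : Part ℕ :=
  Nat.rfindOpt fun k => Nat.ppred (q (Encodable.encode (n :: p.pre k)))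

/-- The partial continuous function `Φ_q :⊆ ℕ^ℕ → ℕ^ℕ` with Kleene associate `q`. Its domain
consists of the `p` at which all values are defined. -/
def kleeneApply (q : Baire) : Baire →. Baire := fun p =>
  ⟨∀ n, (kleeneValue q p n).Dom, fun h n => (kleeneValue q p n).get (h n)⟩

/-- A representation of `X`: a surjective partial map `ℕ^ℕ → X`. -/
structure BaireRepresentation (X : Type*) where
  toPFun : Baire →. X
  surj : ∀ x, ∃ p, x ∈ toPFun p

/-- The partial function whose graph is a right-unique relation. -/
noncomputable def PFun.ofRel {A B : Type*} (R : A → B → Prop) : A →. B := fun a =>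
  ⟨∃ b, R a b, fun h => h.choose⟩

theorem PFun.mem_ofRel {A B : Type*} {R : A → B → Prop}
    (hR : ∀ a b b', R a b → R a b' → b = b') (a : A) (b : B) :
    b ∈ PFun.ofRel R a ↔ R a b := by
  constructor
  · rintro ⟨h, rfl⟩
    exact h.choose_spec
  · intro h
    exact ⟨⟨b, h⟩, hR _ _ _ (Exists.choose_spec (⟨b, h⟩ : ∃ b, R a b)) h⟩

/-- `F` realizes the multivalued partial map `f`: `δ_Y(F(p)) ∈ f(δ_X(p))` whenever `δ_X(p)` exists
and lies in the domain `{x | f x ≠ ∅}` of `f`. -/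
def Realizes {X Y : Type*} (δX : BaireRepresentation X) (δY : BaireRepresentation Y)
    (F : Baire →. Baire) (f : X → Set Y) : Prop :=
  ∀ p, ∀ x ∈ δX.toPFun p, (f x).Nonempty → ∃ r ∈ F p, ∃ y ∈ δY.toPFun r, y ∈ f x

/-- A multivalued partial map of represented spaces is computable if it has a computable
realizer. -/
def ComputableMulti {X Y : Type*} (δX : BaireRepresentation X) (δY : BaireRepresentation Y)
    (f : X → Set Y) : Prop :=
  ∃ F : Baire →. Baire, ComputableOnBaire F ∧ Realizes δX δY F f

/-- Computability of a total single-valued map of represented spaces. -/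
def ComputableMap {X Y : Type*} (δX : BaireRepresentation X) (δY : BaireRepresentation Y)
    (f : X → Y) : Prop :=
  ComputableMulti δX δY fun x => {f x}

/-- A computable embedding: an injective map that is computable together with its partial
inverse. -/
def ComputableEmbedding {X Y : Type*} (δX : BaireRepresentation X) (δY : BaireRepresentation Y)
    (f : X → Y) : Prop :=
  Function.Injective f ∧ ComputableMap δX δY f ∧ ComputableMulti δY δX fun y => {x | f x = y}

/-- The function space representation: `q` is a name of `f : X → Y` if `Φ_q` realizes `f`. -/
def IsFunctionName {X Y : Type*} (δX : BaireRepresentation X) (δY : BaireRepresentation Y)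
    (q : Baire) (f : X → Y) : Prop :=
  Realizes δX δY (kleeneApply q) fun x => {f x}

/-- The Sierpiński space, with underlying set `Prop`: the zero sequence is the only name of
`False`, all other sequences are names of `True`. -/
def sierpinski : BaireRepresentation Prop where
  toPFun p := Part.some (∃ n, p n ≠ 0)
  surj P := by
    by_cases h : P
    · exact ⟨fun _ => 1, by simp [h]⟩
    · exact ⟨fun _ => 0, by simp [h]⟩

namespace BaireRepresentation

variable {X : Type*}

/-- The final topology: `U` is open iff `δ⁻¹(U)` is open in `dom δ ⊆ ℕ^ℕ`. -/
abbrev finalTopology (δ : BaireRepresentation X) : TopologicalSpace X :=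
  TopologicalSpace.coinduced δ.toPFun.asSubtype inferInstance

/-- The set `O(X)` of the open sets of the final topology. -/
def openSets (δ : BaireRepresentation X) : Set (Set X) := {U | IsOpen[δ.finalTopology] U}

theorem isFunctionName_mem_iff (δ : BaireRepresentation X) (q : Baire) (U : Set X) :
    IsFunctionName δ sierpinski q (· ∈ U) ↔
      ∀ p, ∀ x ∈ δ.toPFun p, ∃ r ∈ kleeneApply q p, (∃ n, r n ≠ 0) ↔ x ∈ U := by
  simp only [IsFunctionName, Realizes, sierpinski, Part.mem_some_iff, Set.mem_singleton_iff,
    Set.singleton_nonempty, forall_true_left, exists_eq_left]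
  simp only [eq_iff_iff]

theorem isFunctionName_unique (δ : BaireRepresentation X) (q : Baire) (U V : δ.openSets)
    (hU : IsFunctionName δ sierpinski q (· ∈ U.1))
    (hV : IsFunctionName δ sierpinski q (· ∈ V.1)) : U = V := by
  rw [isFunctionName_mem_iff] at hU hV
  ext x
  obtain ⟨p, hp⟩ := δ.surj x
  obtain ⟨r, hr, h⟩ := hU p x hp
  obtain ⟨s, hs, h'⟩ := hV p x hp
  obtain rfl := Part.mem_unique hr hs
  exact h.symm.trans h'

theorem exists_isFunctionName (δ : BaireRepresentation X) (U : δ.openSets) :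
    ∃ q, IsFunctionName δ sierpinski q (· ∈ U.1) := by
  classical
  let P : List ℕ → Prop := fun w => ∀ p, ∀ x ∈ δ.toPFun p, p.pre w.length = w → x ∈ U.1
  let g : List ℕ → ℕ := fun l => match l with
    | [] => 0
    | n :: w => if w.length = n then (if P w then 2 else 1) else 0
  have hlen : ∀ (p : Baire) k, (p.pre k).length = k := fun p k => by simp [Baire.pre]
  have hval : ∀ (p : Baire) n, (if P (p.pre n) then 1 else 0) ∈
      kleeneValue (fun c => ((Encodable.decode c : Option (List ℕ)).elim 0 g)) p n := by
    intro p n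
    have hd : (kleeneValue (fun c => ((Encodable.decode c : Option (List ℕ)).elim 0 g)) p n).Dom :=
      Nat.rfindOpt_dom.2 ⟨n, (if P (p.pre n) then 1 else 0), by
        by_cases h : P (p.pre n) <;> simp [g, hlen, h, Nat.ppred]⟩
    obtain ⟨v, hv⟩ := Part.dom_iff_mem.1 hd
    obtain ⟨k, hk⟩ := Nat.rfindOpt_spec hv
    by_cases hkn : k = n
    · subst hkn
      convert hv using 1
      by_cases h : P (p.pre k) <;> simp [g, hlen, h, Nat.ppred] at hk ⊢ <;> omega
    · simp [g, hlen, hkn, Nat.ppred] at hk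
  refine ⟨fun c => ((Encodable.decode c : Option (List ℕ)).elim 0 g),
    (isFunctionName_mem_iff _ _ _).2 fun p x hx => ?_⟩
  refine ⟨fun n => if P (p.pre n) then 1 else 0, ⟨fun n => Part.dom_iff_mem.2 ⟨_, hval p n⟩, ?_⟩, ?_⟩
  · funext n
    exact Part.get_eq_of_mem (hval p n) (Part.dom_iff_mem.2 ⟨_, hval p n⟩)
  · constructor
    · rintro ⟨n, hn⟩
      by_cases h : P (p.pre n)
      · exact h p x hx (by rw [hlen])
      · simp [h] at hn
    · intro hxU
      have hU : IsOpen (δ.toPFun.asSubtype ⁻¹' U.1) := U.2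
      obtain ⟨V, hV, hVU⟩ := isOpen_induced_iff.1 hU
      have hmem : ∀ s, ∀ y ∈ δ.toPFun s, s ∈ V ↔ y ∈ U.1 := by
        rintro s y ⟨hs, rfl⟩
        exact Set.ext_iff.1 hVU ⟨s, hs⟩
      obtain ⟨I, u, hu, hIV⟩ := isOpen_pi_iff.1 hV p ((hmem p x hx).2 hxU)
      obtain ⟨N, hN⟩ := I.exists_nat_subset_range
      refine ⟨N, ?_⟩
      have : P (p.pre N) := by
        intro s y hy hs
        refine (hmem s y hy).1 (hIV fun i hi => ?_)
        rw [hlen] at hs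
        have := List.map_inj_left.1 hs i (by simpa using hN hi)
        rw [this]
        exact (hu i hi).2
      simp [this]

/-- The representation `δ_{O(X)}` of `O(X)`: a name of `U` is a name, in the function space
representation, of the characteristic function of `U` into the Sierpiński space. -/
noncomputable def opens (δ : BaireRepresentation X) : BaireRepresentation δ.openSets where
  toPFun := PFun.ofRel fun q (U : δ.openSets) => IsFunctionName δ sierpinski q (· ∈ U.1)
  surj U := (δ.exists_isFunctionName U).imp fun q hq =>
    (PFun.mem_ofRel δ.isFunctionName_unique q U).2 hq

theorem mem_opens (δ : BaireRepresentation X) (q : Baire) (U : δ.openSets) :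
    U ∈ δ.opens.toPFun q ↔ IsFunctionName δ sierpinski q (· ∈ U.1) :=
  PFun.mem_ofRel δ.isFunctionName_unique q U

theorem isOpen_kleeneValue (p : Baire) (n v : ℕ) : IsOpen {q : Baire | v ∈ kleeneValue q p n} := by
  have : {q : Baire | v ∈ kleeneValue q p n} = ⋃ k,
      ({q : Baire | Nat.ppred (q (Encodable.encode (n :: p.pre k))) = some v} ∩
        ⋂ m ∈ Finset.range k, {q : Baire | q (Encodable.encode (n :: p.pre m)) = 0}) := by
    ext q
    simp only [kleeneValue, Nat.rfindOpt, Part.mem_bind_iff, Set.mem_ofPred_eq,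
      Set.mem_iUnion, Set.mem_inter_iff, Set.mem_iInter, Finset.mem_range]
    refine exists_congr fun k => ⟨?_, ?_⟩
    · rintro ⟨h1, h3⟩
      refine ⟨by simpa using h3, fun m hm => ?_⟩
      have := (Nat.mem_rfind.1 h1).2 hm
      generalize q (Encodable.encode (n :: p.pre m)) = a at this ⊢
      cases a <;> simp_all [Nat.ppred]
    · rintro ⟨h1, h2⟩
      refine ⟨Nat.mem_rfind.2 ⟨?_, fun {m} hm => ?_⟩, ?_⟩
      · rw [h1]; simp
      · rw [h2 m hm]; simp [Nat.ppred]
      · rw [h1]; simp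
  rw [this]
  have hc : ∀ (i : ℕ) (A : Set ℕ), IsOpen {q : Baire | q i ∈ A} := fun i A =>
    (isOpen_discrete A).preimage (continuous_apply (A := fun _ : ℕ => ℕ) i)
  exact isOpen_iUnion fun k => IsOpen.inter (hc _ {a | Nat.ppred a = some v})
    (isOpen_biInter_finset fun m _ => hc _ {a | a = 0})

theorem isOpen_nbhd (δ : BaireRepresentation X) (x : X) :
    {U : δ.openSets | x ∈ U.1} ∈ δ.opens.openSets := by
  obtain ⟨p, hp⟩ := δ.surj x
  refine isOpen_induced_iff.2
    ⟨⋃ n, ⋃ v, {q : Baire | v + 1 ∈ kleeneValue q p n},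
      isOpen_iUnion fun n => isOpen_iUnion fun v => isOpen_kleeneValue p n (v + 1), ?_⟩
  ext ⟨q, hq⟩
  have hU := (δ.mem_opens q _).1 (Part.get_mem hq)
  obtain ⟨r, ⟨hd, rfl⟩, hr⟩ := (isFunctionName_mem_iff _ _ _).1 hU p x hp
  simp only [Set.mem_preimage, Set.mem_iUnion, Set.mem_ofPred_eq]
  refine Iff.trans ?_ hr
  refine exists_congr fun n => ⟨?_, fun h => ?_⟩
  · rintro ⟨v, hv⟩
    have := Part.get_eq_of_mem hv (hd n)
    simp only [kleeneApply]
    omega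
  · obtain ⟨v, hv⟩ := Nat.exists_eq_succ_of_ne_zero h
    exact ⟨v, hd n, hv⟩

/-- The neighborhood map `𝒰 : X → OO(X)`, `x ↦ {U ∈ O(X) | x ∈ U}`. -/
def nbhd (δ : BaireRepresentation X) (x : X) : δ.opens.openSets :=
  ⟨{U | x ∈ U.1}, δ.isOpen_nbhd x⟩

/-- `(X, δ)` is a computable Kolmogorov space: the neighborhood map is a computable embedding. -/
def IsComputableKolmogorov (δ : BaireRepresentation X) : Prop :=
  ComputableEmbedding δ δ.opens.opens δ.nbhd

/-- Computable reducibility `δ₁ ≤ δ₂` for representations of sets `A` and `B`: `A ⊆ B` and the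
inclusion is computable. -/
def ReducesTo {A B : Set X} (δ₁ : BaireRepresentation A) (δ₂ : BaireRepresentation B) : Prop :=
  ∃ h : A ⊆ B, ComputableMap δ₁ δ₂ (Set.inclusion h)

/-- Computable equivalence `δ₁ ≡ δ₂`. -/
def Equivalent {A B : Set X} (δ₁ : BaireRepresentation A) (δ₂ : BaireRepresentation B) : Prop :=
  δ₁.ReducesTo δ₂ ∧ δ₂.ReducesTo δ₁

end BaireRepresentation

/-! Membership `x ∈ U` is semidecidable from a name of `x` and a name of `U`, and either name may
act as the program. A `δ`-name of `x` thus yields a name of `𝒰(x)`, so `𝒰` is computable and `id : X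
→ X^•` is too; pulling back along it gives `O(X^•) ≤ O(X)`. Conversely, a `δ^•`-name of `x` is
itself a program that semidecides `x ∈ U` from a name of `U`, which gives `O(X) ≤ O(X^•)`. The
topologies therefore agree. Pulling back along the inclusion `O(X) → O(X^•)` turns a name of the
`X^•`-neighborhoods of `x` into a name of `𝒰(x)`, that is, a `δ^•`-name of `x`; this inverts the
neighborhood map of `X^•`. The computable content is `exists_computable_eval` and
`exists_computable_precomp`, both obtained by currying a search over finite prefixes. -/

namespace Baire

theorem length_pre (p : Baire) (k : ℕ) : (p.pre k).length = k := by simp [pre]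

theorem take_pre (p : Baire) {j k : ℕ} (h : j ≤ k) : (p.pre k).take j = p.pre j := by
  simp [pre, ← List.map_take, List.take_range, h]

theorem getElem?_pre (p : Baire) {i k : ℕ} (h : i < k) : (p.pre k)[i]? = some (p i) := by
  simp [pre, h]

theorem getElem?_pre_eq_some {p : Baire} {i k a : ℕ} (h : (p.pre k)[i]? = some a) : p i = a := by
  by_cases hi : i < k
  · simpa [getElem?_pre p hi] using h
  · simp [pre, hi] at h

theorem isOpen_setOf_pre (A : Set (List ℕ)) (k : ℕ) : IsOpen {p : Baire | p.pre k ∈ A} := by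
  refine isOpen_iff_mem_nhds.2 fun p hp => ?_
  filter_upwards [(PiNat.isOpen_cylinder (fun _ => ℕ) p k).mem_nhds (PiNat.self_mem_cylinder p k)]
    with s hs
  have : s.pre k = p.pre k :=
    List.map_congr_left fun i hi => hs i (List.mem_range.1 hi)
  simpa only [Set.mem_ofPred_eq, this] using hp

end Baire

/-! ### Finite witnesses for values of Kleene associates -/

theorem mem_kleeneValue {q p : Baire} {n v : ℕ} :
    v ∈ kleeneValue q p n ↔ ∃ k, q (Encodable.encode (n :: p.pre k)) = v + 1 ∧
      ∀ j < k, q (Encodable.encode (n :: p.pre j)) = 0 := by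
  simp only [kleeneValue, Nat.rfindOpt, Part.mem_bind_iff]
  refine exists_congr fun k => ⟨?_, ?_⟩
  · rintro ⟨h1, h2⟩
    refine ⟨by simpa [eq_comm] using h2, fun j hj => ?_⟩
    have := (Nat.mem_rfind.1 h1).2 hj
    generalize q (Encodable.encode (n :: p.pre j)) = a at this ⊢
    cases a <;> simp_all [Nat.ppred]
  · rintro ⟨h1, h2⟩
    refine ⟨Nat.mem_rfind.2 ⟨?_, fun {j} hj => ?_⟩, ?_⟩
    · rw [h1]; simp
    · rw [h2 j hj]; simp [Nat.ppred]
    · rw [h1]; simp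

theorem mem_kleeneApply {q p r : Baire} :
    r ∈ kleeneApply q p ↔ ∀ n, r n ∈ kleeneValue q p n := by
  constructor
  · rintro ⟨h, rfl⟩ n
    exact Part.get_mem (h n)
  · intro h
    have hd : ∀ n, (kleeneValue q p n).Dom := fun n => Part.dom_iff_mem.2 ⟨_, h n⟩
    exact ⟨hd, funext fun n => Part.get_eq_of_mem (h n) (hd n)⟩

/-- The finite words `v` and `u` suffice to see that the search for the `m`-th value of
`kleeneApply` stops at `k` with a positive value. -/
def KleenePositive (v u : List ℕ) (m k : ℕ) : Prop :=
  k ≤ u.length ∧ (∀ j < k, v[Encodable.encode (m :: u.take j)]? = some 0) ∧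
    1 < v.getD (Encodable.encode (m :: u.take k)) 0

instance (v u : List ℕ) (m k : ℕ) : Decidable (KleenePositive v u m k) :=
  inferInstanceAs (Decidable (_ ∧ _ ∧ _))

/-- Missing entries never count as evidence: `some 0` requires the entry to be present, and the
default `0` fails `1 <`. The bound is `1` because an associate codes the value `c + 1` as `c + 2`.
-/
theorem KleenePositive.exists_mem_kleeneValue {q r : Baire} {a b m k : ℕ}
    (h : KleenePositive (q.pre a) (r.pre b) m k) : ∃ c, c + 1 ∈ kleeneValue q r m := by
  obtain ⟨hk, h0, h1⟩ := h
  rw [Baire.length_pre] at hk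
  rw [Baire.take_pre r hk, List.getD_eq_getElem?_getD] at h1
  cases hv : (q.pre a)[Encodable.encode (m :: r.pre k)]? with
  | none => rw [hv] at h1; simp at h1
  | some d =>
    rw [hv, Option.getD_some] at h1
    obtain ⟨c, rfl⟩ := Nat.exists_eq_add_of_lt h1
    refine ⟨c, mem_kleeneValue.2 ⟨k, ?_, fun j hj => ?_⟩⟩
    · rw [Baire.getElem?_pre_eq_some hv]; omega
    · have := h0 j hj
      rw [Baire.take_pre r (by omega)] at this
      exact Baire.getElem?_pre_eq_some this

theorem exists_kleenePositive {q r : Baire} {m c : ℕ} (h : c + 1 ∈ kleeneValue q r m) :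
    ∃ k N, ∀ a ≥ N, ∀ b ≥ N, KleenePositive (q.pre a) (r.pre b) m k := by
  obtain ⟨k, hk, h0⟩ := mem_kleeneValue.1 h
  let e : ℕ → ℕ := fun j => Encodable.encode (m :: r.pre j)
  -- `b` must reach `k`, and `a` must exceed the codes of all `k + 1` queries.
  refine ⟨k, k + ((Finset.range (k + 1)).sup e + 1), fun a ha b hb => ?_⟩
  have hlt : ∀ j ≤ k, e j < a := fun j hj => by
    have := Finset.le_sup (f := e) (Finset.mem_range.2 (Nat.lt_succ_of_le hj))
    simp only [Nat.succ_eq_add_one] at this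
    omega
  refine ⟨by rw [Baire.length_pre]; omega, fun j hj => ?_, ?_⟩
  · rw [Baire.take_pre r (by omega), Baire.getElem?_pre q (hlt j hj.le), h0 j hj]
  · rw [Baire.take_pre r (by omega), List.getD_eq_getElem?_getD,
      Baire.getElem?_pre q (hlt k le_rfl), hk, Option.getD_some]
    omega

theorem primrecPred_kleenePositive :
    PrimrecPred fun x : (List ℕ × List ℕ) × ℕ × ℕ => KleenePositive x.1.1 x.1.2 x.2.1 x.2.2 := by
  have hcode : Primrec₂ fun (j : ℕ) (y : (List ℕ × List ℕ) × ℕ) =>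
      Encodable.encode (y.2 :: y.1.2.take j) :=
    Primrec.encode.comp (Primrec.list_cons.comp (Primrec.snd.comp Primrec.snd)
      (Primrec.list_take.comp Primrec.fst (Primrec.snd.comp (Primrec.fst.comp Primrec.snd))))
  have hzero : PrimrecRel fun (j : ℕ) (y : (List ℕ × List ℕ) × ℕ) =>
      y.1.1[Encodable.encode (y.2 :: y.1.2.take j)]? = some 0 :=
    Primrec.eq.comp (Primrec.list_getElem?.comp
      (Primrec.fst.comp (Primrec.fst.comp Primrec.snd)) hcode) (Primrec.const (some 0))
  have hall : PrimrecRel fun (k : ℕ) (y : (List ℕ × List ℕ) × ℕ) =>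
      ∀ j < k, y.1.1[Encodable.encode (y.2 :: y.1.2.take j)]? = some 0 :=
    (hzero.forall_mem_list.comp (Primrec.list_range.comp Primrec.fst) Primrec.snd).of_eq
      fun _ => by simp only [List.mem_range]
  have hy : Primrec fun x : (List ℕ × List ℕ) × ℕ × ℕ => (x.1, x.2.1) :=
    Primrec.fst.pair (Primrec.fst.comp Primrec.snd)
  have hk : Primrec fun x : (List ℕ × List ℕ) × ℕ × ℕ => x.2.2 := Primrec.snd.comp Primrec.snd
  refine PrimrecPred.and ?_ (PrimrecPred.and ?_ ?_)
  · exact Primrec.nat_le.comp hk (Primrec.list_length.comp (Primrec.snd.comp Primrec.fst))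
  · exact hall.comp hk hy
  · exact Primrec.nat_lt.comp (Primrec.const 1) ((Primrec.list_getD 0).comp
      (Primrec.fst.comp Primrec.fst) (hcode.comp hk hy))

/-! ### Currying of semidecision procedures -/

/-- The operator whose `c`-th output is computed from `c` and the first `c` inputs. -/
theorem computableOnBaire_of_pre {g : ℕ → List ℕ → ℕ} (hg : Computable₂ g) :
    ComputableOnBaire fun q => Part.some fun c => g c (q.pre c) := by
  -- The recursive form lets `Computable.nat_rec` apply.
  have hrec : ∀ (v : List ℕ) n, (Nat.rec [] (fun i l => l ++ [g i (v.take i)]) n : List ℕ) =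
      (List.range n).map fun i => g i (v.take i) := by
    intro v n
    induction n with
    | zero => rfl
    | succ n ih => simp [List.range_succ, ← ih]
  have hpre : ∀ (q : Baire) k, (List.range k).map (fun i => g i ((q.pre k).take i)) =
      Baire.pre (fun c => g c (q.pre c)) k := fun q k =>
    List.map_congr_left fun i hi => by rw [Baire.take_pre q (List.mem_range.1 hi).le]
  refine ⟨fun v => (List.range v.length).map fun i => g i (v.take i), ?_, ?_, ?_⟩
  · refine (Computable.nat_rec (f := fun v : List ℕ => v.length) (g := fun _ => ([] : List ℕ))
      (h := fun v x => x.2 ++ [g x.1 (v.take x.1)]) Computable.list_length (Computable.const [])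
      ?_).of_eq fun v => hrec v v.length
    have hi : Computable fun y : List ℕ × ℕ × List ℕ => y.2.1 :=
      Computable.fst.comp Computable.snd
    exact Computable.list_concat.comp (Computable.snd.comp Computable.snd)
      (hg.comp hi (Primrec.list_take.to_comp.comp hi Computable.fst))
  · rintro v _ ⟨w, rfl⟩
    beta_reduce
    rw [List.length_append, List.range_add, List.map_append]
    refine ⟨_, congrArg (· ++ _) (List.map_congr_left fun i hi => ?_)⟩
    rw [List.take_append_of_le_length (List.mem_range.1 hi).le]
  · rintro q r hr
    obtain rfl := Part.mem_some_iff.1 hr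
    refine ⟨fun k => ?_, fun m => ⟨m, ?_⟩⟩
    · simp only [Baire.length_pre, hpre]
    · simp [Baire.length_pre]

/-- A semidecision procedure in two arguments can be curried: the Kleene associate of its section
at `q` is computable from `q`. -/
theorem exists_computable_curry {D : List ℕ → List ℕ → ℕ → Bool}
    (hD : Computable fun x : List ℕ × List ℕ × ℕ => D x.1 x.2.1 x.2.2) :
    ∃ G : Baire → Baire, ComputableOnBaire (fun q => Part.some (G q)) ∧
      ∀ q p, ∃ r ∈ kleeneApply (G q) p, (∃ n, r n ≠ 0) ↔
        ∃ n, D (q.pre (Encodable.encode (n :: p.pre n))) (p.pre n) n = true := by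
  -- A query `n :: w` gets `0` (read on) unless `w` has length `n`; then `2` codes acceptance and
  -- `1` codes the value `0`. Every value is thus defined, at `k = n`.
  let g : ℕ → List ℕ → ℕ := fun c v =>
    let l := ((Encodable.decode c : Option (List ℕ)).getD [])
    bif decide (l.tail.length = l.headI) then (bif D v l.tail l.headI then 2 else 1) else 0
  have hg : Computable₂ g := by
    have hl : Computable fun x : ℕ × List ℕ => (Encodable.decode x.1 : Option (List ℕ)).getD [] :=
      Computable.option_getD (Computable.decode.comp Computable.fst) (Computable.const [])
    have ht := (Primrec.list_tail (α := ℕ)).to_comp.comp hl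
    have hh := (Primrec.list_headI (α := ℕ)).to_comp.comp hl
    refine Computable.cond ?_ (Computable.cond ?_ (Computable.const 2) (Computable.const 1))
      (Computable.const 0)
    · exact Primrec.eq.decide.to_comp.comp (Computable.list_length.comp ht) hh
    · exact hD.comp (Computable.snd.pair (ht.pair hh))
  refine ⟨fun q c => g c (q.pre c), computableOnBaire_of_pre hg, fun q p => ?_⟩
  refine ⟨fun n => bif D (q.pre (Encodable.encode (n :: p.pre n))) (p.pre n) n then 1 else 0,
    mem_kleeneApply.2 fun n => mem_kleeneValue.2 ⟨n, ?_, fun j hj => ?_⟩, ?_⟩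
  · simp only [g, Encodable.encodek, Option.getD_some, List.tail_cons, List.headI_cons,
      Baire.length_pre, decide_true, cond_true]
    cases D (q.pre (Encodable.encode (n :: p.pre n))) (p.pre n) n <;> rfl
  · simp [g, Baire.length_pre, hj.ne]
  · refine exists_congr fun n => ?_
    beta_reduce
    generalize D (q.pre (Encodable.encode (n :: p.pre n))) (p.pre n) n = b
    cases b <;> simp

/-- Ensures that the prefix of the parameter inspected at stage `n` has length at least `n`. -/
theorem le_encode_cons (n : ℕ) (l : List ℕ) : n ≤ Encodable.encode (n :: l) :=
  (Nat.left_le_pair n (Encodable.encode l)).trans (Nat.le_succ _)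

theorem exists_ne_zero_iff_of_mem_kleeneApply {q p r : Baire} (h : r ∈ kleeneApply q p) :
    (∃ n, r n ≠ 0) ↔ ∃ m c, c + 1 ∈ kleeneValue q p m := by
  refine exists_congr fun n => ⟨fun hn => ?_, ?_⟩
  · obtain ⟨c, hc⟩ := Nat.exists_eq_succ_of_ne_zero hn
    have := mem_kleeneApply.1 h n
    rw [hc] at this
    exact ⟨c, this⟩
  · rintro ⟨c, hc⟩
    rw [Part.mem_unique (mem_kleeneApply.1 h n) hc]
    exact Nat.succ_ne_zero c

/-- Stage `n` tests the pair `(m, k)` it codes; the padding by `N` makes each pair recur at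
arbitrarily late stages. -/
theorem exists_ge_unpair_eq (m k N : ℕ) :
    ∃ n ≥ N, n.unpair.1 = m ∧ n.unpair.2.unpair.1 = k :=
  ⟨Nat.pair m (Nat.pair k N), (Nat.right_le_pair _ _).trans (Nat.right_le_pair _ _), by simp⟩

theorem computable_decide_kleenePositive {α : Type*} [Primcodable α] {v u : α → List ℕ}
    {m k : α → ℕ} (hv : Computable v) (hu : Computable u) (hm : Computable m) (hk : Computable k) :
    Computable fun x => decide (KleenePositive (v x) (u x) (m x) (k x)) :=
  primrecPred_kleenePositive.decide.to_comp.comp ((hv.pair hu).pair (hm.pair hk))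

theorem computable_unpair_components :
    (Computable fun x : List ℕ × List ℕ × ℕ => x.2.2.unpair.1) ∧
      Computable fun x : List ℕ × List ℕ × ℕ => x.2.2.unpair.2.unpair.1 := by
  have hn : Computable fun x : List ℕ × List ℕ × ℕ => x.2.2.unpair :=
    Computable.unpair.comp (Computable.snd.comp Computable.snd)
  have hn' : Computable fun x : List ℕ × List ℕ × ℕ => x.2.2.unpair.2.unpair :=
    Computable.unpair.comp (Computable.snd.comp hn)
  exact ⟨Computable.fst.comp hn, Computable.fst.comp hn'⟩

/-- Precomposition with a computable operator is computable on names of semidecision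
procedures. -/
theorem exists_computable_precomp {F : Baire →. Baire} (hF : ComputableOnBaire F) :
    ∃ G : Baire → Baire, ComputableOnBaire (fun q => Part.some (G q)) ∧
      ∀ q p, ∀ r ∈ F p, ∀ s ∈ kleeneApply q r,
        ∃ s' ∈ kleeneApply (G q) p, (∃ n, s' n ≠ 0) ↔ ∃ n, s n ≠ 0 := by
  obtain ⟨f, hf, hmono, hlim⟩ := hF
  obtain ⟨G, hG, h⟩ := exists_computable_curry
    (D := fun v w n => decide (KleenePositive v (f w) n.unpair.1 n.unpair.2.unpair.1))
    (computable_decide_kleenePositive Computable.fst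
      (hf.comp (Computable.fst.comp Computable.snd))
      computable_unpair_components.1 computable_unpair_components.2)
  refine ⟨G, hG, fun q p r hr s hs => ?_⟩
  obtain ⟨s', hs', hiff⟩ := h q p
  refine ⟨s', hs', ?_⟩
  rw [hiff, exists_ne_zero_iff_of_mem_kleeneApply hs]
  obtain ⟨hpre, hlen⟩ := hlim p r hr
  constructor
  · rintro ⟨n, hn⟩
    have hn := of_decide_eq_true hn
    rw [hpre] at hn
    exact ⟨_, hn.exists_mem_kleeneValue⟩
  · rintro ⟨m, c, hc⟩
    obtain ⟨k, N, hN⟩ := exists_kleenePositive hc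
    obtain ⟨t, ht⟩ := hlen N
    obtain ⟨n, hn, rfl, rfl⟩ := exists_ge_unpair_eq m k (max t N)
    refine ⟨n, decide_eq_true ?_⟩
    -- Stage `n` sees at least the output of stage `t`, by monotonicity of `f`.
    have hle : (f (p.pre t)).length ≤ (f (p.pre n)).length := by
      refine (hmono _ _ ?_).length_le
      rw [← Baire.take_pre p ((le_max_left _ _).trans hn)]
      exact List.take_prefix _ _
    rw [hpre]
    exact hN _ (((le_max_right _ _).trans hn).trans (le_encode_cons _ _)) _ (ht.trans hle)

/-- Evaluation at a point is computable from the point, on names of semidecision procedures. -/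
theorem exists_computable_eval :
    ∃ G : Baire → Baire, ComputableOnBaire (fun q => Part.some (G q)) ∧
      ∀ q p, ∀ s ∈ kleeneApply p q,
        ∃ s' ∈ kleeneApply (G q) p, (∃ n, s' n ≠ 0) ↔ ∃ n, s n ≠ 0 := by
  obtain ⟨G, hG, h⟩ := exists_computable_curry
    -- The point `p` is the associate here, and the parameter `q` is its input.
    (D := fun v w n => decide (KleenePositive w v n.unpair.1 n.unpair.2.unpair.1))
    (computable_decide_kleenePositive (Computable.fst.comp Computable.snd) Computable.fst
      computable_unpair_components.1 computable_unpair_components.2)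
  refine ⟨G, hG, fun q p s hs => ?_⟩
  obtain ⟨s', hs', hiff⟩ := h q p
  refine ⟨s', hs', ?_⟩
  rw [hiff, exists_ne_zero_iff_of_mem_kleeneApply hs]
  constructor
  · rintro ⟨n, hn⟩
    exact ⟨_, (of_decide_eq_true hn).exists_mem_kleeneValue⟩
  · rintro ⟨m, c, hc⟩
    obtain ⟨k, N, hN⟩ := exists_kleenePositive hc
    obtain ⟨n, hn, rfl, rfl⟩ := exists_ge_unpair_eq m k N
    refine ⟨n, decide_eq_true ?_⟩
    exact hN _ hn _ (hn.trans (le_encode_cons _ _))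

/-! ### The neighborhood map and the representation `δ^•` -/

namespace BaireRepresentation

variable {X : Type*}

/-- Acceptance depends on a finite prefix of the input. Hence translating names already yields the
inclusion of topologies. -/
theorem mem_openSets_of_isFunctionName {δ : BaireRepresentation X} {q : Baire} {U : Set X}
    (h : IsFunctionName δ sierpinski q (· ∈ U)) : U ∈ δ.openSets := by
  rw [isFunctionName_mem_iff] at h
  refine isOpen_induced_iff.2 ⟨{p | ∃ m c, c + 1 ∈ kleeneValue q p m}, ?_, ?_⟩
  · have : {p : Baire | ∃ m c, c + 1 ∈ kleeneValue q p m} = ⋃ m, ⋃ c, ⋃ k,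
        ({p : Baire | p.pre k ∈ {l | q (Encodable.encode (m :: l)) = c + 1 + 1}} ∩
          ⋂ j ∈ Finset.range k, {p : Baire | p.pre j ∈ {l | q (Encodable.encode (m :: l)) = 0}}) := by
      ext p
      simp [mem_kleeneValue]
    rw [this]
    exact isOpen_iUnion fun m => isOpen_iUnion fun c => isOpen_iUnion fun k =>
      (Baire.isOpen_setOf_pre _ _).inter
        (isOpen_biInter_finset fun j _ => Baire.isOpen_setOf_pre _ _)
  · ext ⟨p, hp⟩
    obtain ⟨r, hr, hiff⟩ := h p _ (Part.get_mem hp)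
    exact (exists_ne_zero_iff_of_mem_kleeneApply hr).symm.trans hiff

theorem nbhd_injective (δ : BaireRepresentation X) (hT0 : @T0Space X δ.finalTopology) :
    Function.Injective δ.nbhd := by
  intro x y hxy
  let := δ.finalTopology
  refine hT0.t0 (inseparable_iff_forall_isOpen.2 fun U hU => ?_)
  exact Set.ext_iff.1 (congrArg Subtype.val hxy) ⟨U, hU⟩

theorem computableMap_nbhd (δ : BaireRepresentation X) :
    ComputableMap δ δ.opens.opens δ.nbhd := by
  obtain ⟨G, hG, h⟩ := exists_computable_eval
  refine ⟨_, hG, fun p x hx _ => ⟨G p, Part.mem_some _, δ.nbhd x, ?_, rfl⟩⟩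
  refine (mem_opens _ _ _).2 ((isFunctionName_mem_iff _ _ _).2 fun q U hU => ?_)
  obtain ⟨s, hs, hsU⟩ := (isFunctionName_mem_iff _ _ _).1 ((mem_opens _ _ _).1 hU) p x hx
  obtain ⟨s', hs', hiff⟩ := h p q s hs
  exact ⟨s', hs', hiff.trans hsU⟩

/-- Open sets pull back along a computable map, computably in their names. -/
theorem exists_computable_preimage {Y : Type*} {δX : BaireRepresentation X}
    {δY : BaireRepresentation Y} {f : X → Y} (hf : ComputableMap δX δY f) :
    ∃ G : Baire → Baire, ComputableOnBaire (fun q => Part.some (G q)) ∧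
      ∀ q U, IsFunctionName δY sierpinski q (· ∈ U) →
        IsFunctionName δX sierpinski (G q) (· ∈ f ⁻¹' U) := by
  obtain ⟨F, hF, hreal⟩ := hf
  obtain ⟨G, hG, h⟩ := exists_computable_precomp hF
  refine ⟨G, hG, fun q U hU => (isFunctionName_mem_iff _ _ _).2 fun p x hx => ?_⟩
  obtain ⟨r, hr, y, hy, rfl⟩ := hreal p x hx ⟨_, rfl⟩
  obtain ⟨s, hs, hsU⟩ := (isFunctionName_mem_iff _ _ _).1 hU r _ hy
  obtain ⟨s', hs', hiff⟩ := h q p r hr s hs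
  exact ⟨s', hs', hiff.trans hsU⟩

theorem reducesTo_opens_of_forall {δ₁ δ₂ : BaireRepresentation X} {G : Baire → Baire}
    (hG : ComputableOnBaire (fun q => Part.some (G q)))
    (h : ∀ q, ∀ U ∈ δ₁.openSets, IsFunctionName δ₁ sierpinski q (· ∈ U) →
      IsFunctionName δ₂ sierpinski (G q) (· ∈ U)) :
    δ₁.opens.ReducesTo δ₂.opens := by
  have hsub : δ₁.openSets ⊆ δ₂.openSets := fun U hU => by
    obtain ⟨q, hq⟩ := δ₁.exists_isFunctionName ⟨U, hU⟩
    exact mem_openSets_of_isFunctionName (h q U hU hq)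
  exact ⟨hsub, _, hG, fun q U hU _ => ⟨G q, Part.mem_some _, Set.inclusion hsub U,
    (mem_opens _ _ _).2 (h q U U.2 ((mem_opens _ _ _).1 hU)), rfl⟩⟩

/-- The representation `𝒰⁻¹ ∘ δ_{OO(X)}` of a `T₀` represented space. -/
noncomputable def kolmogorov (δ : BaireRepresentation X) (hT0 : @T0Space X δ.finalTopology) :
    BaireRepresentation X where
  toPFun := PFun.ofRel fun p x => δ.nbhd x ∈ δ.opens.opens.toPFun p
  surj x := (δ.opens.opens.surj (δ.nbhd x)).imp fun p hp =>
    (PFun.mem_ofRel (fun _ _ _ h h' => δ.nbhd_injective hT0 (Part.mem_unique h h')) p x).2 hp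

variable (δ : BaireRepresentation X) (hT0 : @T0Space X δ.finalTopology)

theorem mem_kolmogorov (p : Baire) (x : X) :
    x ∈ (δ.kolmogorov hT0).toPFun p ↔ δ.nbhd x ∈ δ.opens.opens.toPFun p :=
  PFun.mem_ofRel (fun _ _ _ h h' => δ.nbhd_injective hT0 (Part.mem_unique h h')) p x

/-- A realizer of `δ.nbhd` serves unchanged. -/
theorem computableMap_id_kolmogorov : ComputableMap δ (δ.kolmogorov hT0) id := by
  obtain ⟨F, hF, h⟩ := δ.computableMap_nbhd
  refine ⟨F, hF, fun p x hx hne => ?_⟩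
  obtain ⟨r, hr, _, hy, rfl⟩ := h p x hx ⟨_, rfl⟩
  exact ⟨r, hr, x, (mem_kolmogorov _ _ _ _).2 hy, rfl⟩

theorem kolmogorov_opens_reducesTo : (δ.kolmogorov hT0).opens.ReducesTo δ.opens := by
  obtain ⟨G, hG, h⟩ := exists_computable_preimage (δ.computableMap_id_kolmogorov hT0)
  exact reducesTo_opens_of_forall hG fun q U _ => h q U

theorem opens_reducesTo_kolmogorov : δ.opens.ReducesTo (δ.kolmogorov hT0).opens := by
  obtain ⟨G, hG, h⟩ := exists_computable_eval
  refine reducesTo_opens_of_forall hG fun q U hU hq =>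
    (isFunctionName_mem_iff _ _ _).2 fun p x hx => ?_
  have hp := (mem_opens _ _ _).1 ((mem_kolmogorov _ _ _ _).1 hx)
  obtain ⟨s, hs, hsU⟩ := (isFunctionName_mem_iff _ _ _).1 hp q ⟨U, hU⟩ ((mem_opens _ _ _).2 hq)
  obtain ⟨s', hs', hiff⟩ := h q p s hs
  exact ⟨s', hs', hiff.trans hsU⟩

theorem kolmogorov_finalTopology : (δ.kolmogorov hT0).finalTopology = δ.finalTopology :=
  TopologicalSpace.ext_iff.2 fun _ =>
    ⟨fun h => (δ.kolmogorov_opens_reducesTo hT0).1 h,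
      fun h => (δ.opens_reducesTo_kolmogorov hT0).1 h⟩

theorem isComputableKolmogorov_kolmogorov : (δ.kolmogorov hT0).IsComputableKolmogorov := by
  obtain ⟨hsub, hred⟩ := δ.opens_reducesTo_kolmogorov hT0
  refine ⟨nbhd_injective _ (by rwa [kolmogorov_finalTopology]), computableMap_nbhd _, ?_⟩
  -- The preimage of `(δ.kolmogorov hT0).nbhd x` under the inclusion of open sets is `δ.nbhd x`.
  obtain ⟨G, hG, h⟩ := exists_computable_preimage hred
  refine ⟨_, hG, ?_⟩
  rintro p _ hp ⟨x, rfl⟩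
  refine ⟨G p, Part.mem_some _, x, (mem_kolmogorov _ _ _ _).2 ((mem_opens _ _ _).2 ?_), rfl⟩
  exact h p _ ((mem_opens _ _ _).1 hp)

end BaireRepresentation

theorem theorem25 {X : Type*} (δ : BaireRepresentation X) (hT0 : @T0Space X δ.finalTopology) :
    ∃ δ' : BaireRepresentation X,
      (∀ p x, x ∈ δ'.toPFun p ↔ δ.nbhd x ∈ δ.opens.opens.toPFun p) ∧
      δ'.IsComputableKolmogorov ∧
      δ'.finalTopology = δ.finalTopology ∧
      δ'.opens.Equivalent δ.opens :=
  ⟨δ.kolmogorov hT0, δ.mem_kolmogorov hT0, δ.isComputableKolmogorov_kolmogorov hT0,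
    δ.kolmogorov_finalTopology hT0, δ.kolmogorov_opens_reducesTo hT0,
    δ.opens_reducesTo_kolmogorov hT0⟩
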